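/- For a hypergraph $H$ with a finite vertex set $V(H)$ and hyperedge set $E(H)$ (a set of subsets of $V(H)$), and a coloring $(X_v)_{v\in V(H)}$ of its vertices, let $$T(H)=\bigl|\{e\in E(H): X_v=X_{v'}\text{ for all }v,v'\in e\}\bigr|$$ be the number of monochromatic hyperedges; $H$ is $r$-uniform if $|e|=r$ for every $e\in E(H)$. Fix $d\ge 1$, integers $r_1,\dots,r_d\ge 2$ and constants $\lambda_1,\dots,\lambda_d\ge 0$. For each $n$ let $\boldsymbol H_n=(H_n^{(1)},\dots,H_n^{(d)})$ be a $d$-layered multiplex hypergraph, that is, a $d$-tuple of hypergraphs with a common finite vertex set $V_n$, such that $H_n^{(i)}$ is $r_i$-uniform for $1\le i\le d$. Let the vertices in $V_n$ be colored uniformly at random with $c_n$ colors, i.e. the colors $X_v$, $v\in V_n$, are independent and each is uniformly distributed on $\{1,\dots,c_n\}$, where $c_n\to\infty$ as $n\to\infty$. Suppose that - for $1\le i\le d$, $\displaystyle\lim_{n\to\infty}\mathbb E\,T(H_n^{(i)})=\lim_{n\to\infty}\operatorname{Var}T(H_n^{(i)})=\lambda_i$; - for every $n$ and all $1\le i\ne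 j\le d$, $E(H_n^{(i)})\cap E(H_n^{(j)})=\emptyset$. Then, as $n\to\infty$, $$\bigl(T(H_n^{(1)}),\dots,T(H_n^{(d)})\bigr)\ \xrightarrow{\ d\ }\ (Z_1,\dots,Z_d),$$ where $Z_1\sim\mathrm{Pois}(\lambda_1),\dots,Z_d\sim\mathrm{Pois}(\lambda_d)$ are independent. -/

import Mathlib

open Set Filter Topology MeasureTheory ProbabilityTheory
open scoped NNReal ENNReal

/-- A hypergraph is `r`-uniform if each of its hyperedges consists of exactly `r` vertices. -/
def Hypergraph.IsUniform {V : Type*} (H : Hypergraph V) (r : ℕ) : Prop :=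
  ∀ e ∈ H.edgeSet, e.ncard = r

/-- A `d`-layered multiplex hypergraph (`d`-hypermultiplex) with vertex set `V`: a `d`-tuple of
hypergraphs which all have the same vertex set, namely the whole of `V`. -/
structure Hypermultiplex (V : Type*) (d : ℕ) where
  /-- The layers of the multiplex. -/
  layer : Fin d → Hypergraph V
  /-- All layers have the common vertex set `V`. -/
  vertexSet_layer : ∀ i, (layer i).vertexSet = Set.univ

/-- A set `e` of vertices is monochromatic under the coloring `x` if all its vertices have the
same color. -/
def IsMonochromatic {V C : Type*} (x : V → C) (e : Set V) : Prop :=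
  ∀ v ∈ e, ∀ w ∈ e, x v = x w

/-- The number `T(H)` of monochromatic hyperedges of `H` under the coloring `x`. It is only used
for hypergraphs on a finite vertex set, where the set counted here is finite. -/
noncomputable def monoCount {V C : Type*} (H : Hypergraph V) (x : V → C) : ℕ :=
  {e | e ∈ H.edgeSet ∧ IsMonochromatic x e}.ncard

/-- `X` is a uniformly random coloring of `V` with `c` colors on the probability space `(Ω, P)`:
`X v` is the color of the vertex `v`, the colors of the different vertices are independent random
variables, and each vertex has each of the `c` colors with probability `1 / c`. -/
structure IsUniformColoring {V Ω : Type*} [MeasurableSpace Ω] (P : Measure Ω) {c : ℕ}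
    (X : V → Ω → Fin c) : Prop where
  measurable : ∀ v, Measurable (X v)
  indep : iIndepFun X P
  prob_eq : ∀ v a, P {ω | X v ω = a} = (c : ℝ≥0∞)⁻¹

/-! Write I_e for the indicator that e is monochromatic and p_e for its probability. Conditioning on
I_e = 1 amounts to giving all of e the color of a root u ∈ e (`expect_monoInd_mul`), which leaves
I_f unchanged unless f meets e outside u. Hence h(t) = E ∏ (1 + t y_e I_e) nearly solves h' = L h
with L = ∑ p_e y_e, and h(1) is close to exp L (`norm_expect_prod_sub_exp_le`). With y_e = z_i - 1
on layer i, this compares the joint generating function with that of independent Poisson variables.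

The error consists of ∑ p_e² and the joint probabilities of pairs meeting outside the root. Pairs
sharing at least two vertices are positively correlated; within a layer their total is at most 2
(Var - mean + ∑ p_e²), which tends to 0 (`overlapSum_self_le`). Between layers, Cauchy–Schwarz over
the common part S = e ∩ f reduces to single layers (`overlapSum_sq_le`).

Pairs sharing exactly one vertex are uncorrelated, so the variance does not see them, and their
total need not be small, as for a star. Rooting e at a vertex of maximal weighted degree D leaves
only shared vertices v with D(v) ≤ √(D(u) D(v)); Cauchy–Schwarz then brings in the sum of squared
codegrees, which tends to 0 (`exists_root_sum_neighborSum_le`). Characteristic functions therefore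
converge, and Lévy's continuity theorem concludes. -/

open scoped BigOperators

/-! ### Uniform colorings and the size-bias identity. -/

section Coloring

variable {V C : Type*} [DecidableEq V]

/-- The coloring obtained from `x` by giving all vertices of `s` the color of `u`. -/
def recolor (s : Finset V) (u : V) (x : V → C) : V → C :=
  fun v => if v ∈ s then x u else x v

open Classical in
/-- The indicator that the hyperedge `e` is monochromatic. -/
noncomputable def monoInd (K : Type*) [Zero K] [One K] (e : Finset V) (x : V → C) : K :=
  if IsMonochromatic x (e : Set V) then 1 else 0

/-- The probability that the hyperedge `e` is monochromatic under a uniform coloring with `q`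
colors. -/
noncomputable def edgeProb (q : ℕ) (e : Finset V) : ℝ := ((q : ℝ)⁻¹) ^ (e.card - 1)

/-- The probability that both hyperedges are monochromatic. -/
noncomputable def pairProb (q : ℕ) (e f : Finset V) : ℝ :=
  edgeProb q e * edgeProb q f * (q : ℝ) ^ ((e ∩ f).card - 1)

lemma isMonochromatic_iff_erase {e : Finset V} {u : V} (hu : u ∈ e) (x : V → C) :
    IsMonochromatic x (e : Set V) ↔ ∀ v ∈ e.erase u, x v = x u := by
  constructor
  · intro h v hv
    exact h v (Finset.mem_of_mem_erase hv) u hu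
  · intro h
    have h' : ∀ v ∈ e, x v = x u := fun v hv => by
      by_cases hvu : v = u
      · rw [hvu]
      · exact h v (Finset.mem_erase.2 ⟨hvu, hv⟩)
    intro v hv w hw
    rw [h' v hv, h' w hw]


/-- Recoloring `e` with the color of `u` does not affect sets that meet `e` at most in `u`. -/
lemma monoInd_recolor_of_inter_subset {K : Type*} [Zero K] [One K]
    {e f : Finset V} {u : V} (h : e ∩ f ⊆ {u}) (x : V → C) :
    monoInd K f (recolor (e.erase u) u x) = monoInd K f x := by
  have h' : ∀ v ∈ f, recolor (e.erase u) u x v = x v := by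
    intro v hv
    simp only [recolor, Finset.mem_erase]
    split_ifs with hve
    · exact absurd (Finset.mem_singleton.1 (h (Finset.mem_inter.2 ⟨hve.2, hv⟩))) hve.1
    · rfl
  unfold monoInd
  congr 1
  refine propext (forall₂_congr fun v hv => forall₂_congr fun w hw => ?_)
  rw [h' v hv, h' w hw]

variable [Fintype V] [Fintype C]

/-- Resampling the color of one vertex preserves the uniform distribution on colorings. -/
lemma sum_sum_update {M : Type*} [AddCommMonoid M] (w : V) (F : (V → C) → M) :
    ∑ x : V → C, ∑ a : C, F (Function.update x w a) = Fintype.card C • ∑ x, F x := by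
  -- Exchanging the new color with the one it replaces is an involution on pairs (coloring, color).
  have hinv : Function.Involutive
      (fun y : (V → C) × C => (Function.update y.1 w y.2, y.1 w)) := by
    rintro ⟨x, a⟩
    simp
  have h := Fintype.sum_equiv (hinv.toPerm _)
    (fun y : (V → C) × C => F (Function.update y.1 w y.2)) (fun y => F y.1) (fun y => rfl)
  rw [Fintype.sum_prod_type, Fintype.sum_prod_type] at h
  rw [h, Finset.smul_sum]
  simp

variable [Nonempty C] {K : Type*} [Field K] [CharZero K]

-- When the color of w is resampled, exactly one of the possible colors agrees with that of u.
open Classical in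
lemma expect_eq_color {u w : V} (h : u ≠ w) (g : (V → C) → K) :
    𝔼 x : V → C, (if x w = x u then g x else 0) =
      (Fintype.card C : K)⁻¹ * 𝔼 x : V → C, g (Function.update x w (x u)) := by
  have hC : (Fintype.card C : K) ≠ 0 := by simp
  have h1 := sum_sum_update w (fun x : V → C => if x w = x u then g x else 0)
  simp only [Function.update_self, Function.update_of_ne h, Finset.sum_ite_eq',
    Finset.mem_univ, if_true, nsmul_eq_mul] at h1
  rw [Fintype.expect_eq_sum_div_card, Fintype.expect_eq_sum_div_card, h1]
  field_simp

open Classical in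
/-- Conditionally on the vertices of `insert u s` having the same color, the coloring is
distributed as the recoloring of a uniform one. -/
lemma expect_agree {u : V} {s : Finset V} (hu : u ∉ s) (g : (V → C) → K) :
    𝔼 x : V → C, (if ∀ v ∈ s, x v = x u then g x else 0) =
      ((Fintype.card C : K)⁻¹) ^ s.card * 𝔼 x : V → C, g (recolor s u x) := by
  induction s using Finset.induction_on generalizing g with
  | empty =>
    have : ∀ x : V → C, recolor ∅ u x = x := fun x => by funext v; simp [recolor]
    simp [this]
  | insert w s hw ih =>
    have hus : u ∉ s := fun h => hu (Finset.mem_insert_of_mem h)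
    have huw : u ≠ w := fun h => hu (h ▸ Finset.mem_insert_self _ _)
    have h1 : ∀ x : V → C, (if ∀ v ∈ insert w s, x v = x u then g x else 0) =
        if x w = x u then (if ∀ v ∈ s, x v = x u then g x else 0) else 0 := by
      intro x
      simp only [Finset.forall_mem_insert]
      split_ifs <;> tauto
    simp only [h1]
    rw [expect_eq_color huw]
    have h2 : ∀ x : V → C, (∀ v ∈ s, Function.update x w (x u) v = Function.update x w (x u) u) ↔
        ∀ v ∈ s, x v = x u := by
      intro x
      refine forall₂_congr fun v hv => ?_
      rw [Function.update_of_ne huw, Function.update_of_ne (ne_of_mem_of_not_mem hv hw)]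
    simp only [h2]
    rw [ih hus (fun x => g (Function.update x w (x u))), Finset.card_insert_of_notMem hw,
      pow_succ', mul_assoc]
    congr 2
    refine Finset.expect_congr rfl fun x _ => congrArg g ?_
    funext v
    by_cases hv : v = w <;> simp [recolor, Function.update_apply, hv, hus]

/-- Size-bias identity for the indicator of a monochromatic hyperedge. -/
lemma expect_monoInd_mul {e : Finset V} {u : V} (hu : u ∈ e) (g : (V → C) → K) :
    𝔼 x : V → C, monoInd K e x * g x =
      ((Fintype.card C : K)⁻¹) ^ (e.card - 1) * 𝔼 x : V → C, g (recolor (e.erase u) u x) := by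
  rw [← Finset.card_erase_of_mem hu, ← expect_agree (Finset.notMem_erase u e)]
  refine Finset.expect_congr rfl fun x _ => ?_
  have h := isMonochromatic_iff_erase hu x
  unfold monoInd
  split_ifs <;> simp_all

lemma expect_monoInd {e : Finset V} (he : e.Nonempty) :
    𝔼 x : V → C, monoInd ℝ e x = edgeProb (Fintype.card C) e := by
  obtain ⟨u, hu⟩ := he
  have := expect_monoInd_mul (C := C) hu (fun _ => (1 : ℝ))
  simpa [edgeProb] using this

/-- If e and f share a vertex, both are monochromatic exactly when e ∪ f is. If they are disjoint,
recoloring e does not touch f and the probabilities multiply. -/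
lemma expect_monoInd_mul_monoInd {e f : Finset V} (he : e.Nonempty) (hf : f.Nonempty) :
    𝔼 x : V → C, monoInd ℝ e x * monoInd ℝ f x = pairProb (Fintype.card C) e f := by
  have hC : (Fintype.card C : ℝ) ≠ 0 := by simp
  by_cases hef : (e ∩ f).Nonempty
  · obtain ⟨u, hu⟩ := hef
    have hue := (Finset.mem_inter.1 hu).1
    have huf := (Finset.mem_inter.1 hu).2
    have h1 : ∀ x : V → C, monoInd ℝ e x * monoInd ℝ f x = monoInd ℝ (e ∪ f) x := by
      intro x
      have : IsMonochromatic x ((e ∪ f : Finset V) : Set V) ↔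
          IsMonochromatic x (e : Set V) ∧ IsMonochromatic x (f : Set V) := by
        rw [isMonochromatic_iff_erase (Finset.mem_union_left _ hue),
          isMonochromatic_iff_erase hue, isMonochromatic_iff_erase huf]
        simp only [Finset.mem_erase, Finset.mem_union]
        grind
      simp only [monoInd, this]
      split_ifs <;> simp_all
    simp only [h1]
    rw [expect_monoInd ⟨u, Finset.mem_union_left _ hue⟩]
    have hcard := Finset.card_union_add_card_inter e f
    have h2 : 0 < (e ∩ f).card := Finset.card_pos.2 ⟨u, hu⟩
    have h3 : (e ∩ f).card ≤ e.card := Finset.card_le_card Finset.inter_subset_left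
    have h4 : (e ∩ f).card ≤ f.card := Finset.card_le_card Finset.inter_subset_right
    have h5 : (e.card - 1) + (f.card - 1) = ((e ∪ f).card - 1) + ((e ∩ f).card - 1) := by omega
    rw [pairProb, edgeProb, edgeProb, edgeProb, ← pow_add, h5, pow_add, mul_assoc, ← mul_pow,
      inv_mul_cancel₀ hC, one_pow, mul_one]
  · rw [Finset.not_nonempty_iff_eq_empty] at hef
    obtain ⟨u, hu⟩ := he
    rw [expect_monoInd_mul hu]
    have h1 : ∀ x : V → C, monoInd ℝ f (recolor (e.erase u) u x) = monoInd ℝ f x :=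
      monoInd_recolor_of_inter_subset (by simp [hef])
    simp only [h1]
    rw [expect_monoInd hf]
    -- Truncated subtraction gives the exponent 0 for an empty intersection, as for a single common
    -- vertex.
    simp [pairProb, hef, edgeProb]

end Coloring

/-! ### Poisson approximation of the generating function. -/

section GeneratingFunction

lemma norm_expect_le {ι : Type*} [Fintype ι] (f : ι → ℂ) : ‖𝔼 i, f i‖ ≤ 𝔼 i, ‖f i‖ := by
  rw [Fintype.expect_eq_sum_div_card, Fintype.expect_eq_sum_div_card, norm_div]
  simp only [Complex.norm_natCast]
  gcongr
  exact norm_sum_le _ _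

lemma norm_prod_sub_prod_le {ι : Type*} (s : Finset ι) (a b : ι → ℂ) (ha : ∀ i ∈ s, ‖a i‖ ≤ 1)
    (hb : ∀ i ∈ s, ‖b i‖ ≤ 1) : ‖∏ i ∈ s, a i - ∏ i ∈ s, b i‖ ≤ ∑ i ∈ s, ‖a i - b i‖ := by
  classical
  induction s using Finset.induction_on with
  | empty => simp
  | insert i s hi ih =>
    simp only [Finset.forall_mem_insert] at ha hb
    rw [Finset.prod_insert hi, Finset.prod_insert hi, Finset.sum_insert hi]
    have h1 : a i * ∏ j ∈ s, a j - b i * ∏ j ∈ s, b j =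
        (a i - b i) * ∏ j ∈ s, a j + b i * (∏ j ∈ s, a j - ∏ j ∈ s, b j) := by ring
    have h2 : ‖∏ j ∈ s, a j‖ ≤ 1 := by
      rw [norm_prod]
      exact Finset.prod_le_one (fun _ _ => norm_nonneg _) ha.2
    rw [h1]
    refine (norm_add_le _ _).trans ?_
    rw [norm_mul, norm_mul]
    exact add_le_add (mul_le_of_le_one_right (norm_nonneg _) h2)
      ((mul_le_of_le_one_left (norm_nonneg _) hb.1).trans (ih ha.2 hb.2))

variable {V C : Type*}

lemma monoInd_eq_zero_or_one (K : Type*) [Zero K] [One K] (e : Finset V) (x : V → C) :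
    monoInd K e x = 0 ∨ monoInd K e x = 1 := by
  unfold monoInd
  split_ifs <;> simp

lemma monoInd_nonneg (e : Finset V) (x : V → C) : 0 ≤ monoInd ℝ e x := by
  rcases monoInd_eq_zero_or_one ℝ e x with h | h <;> simp [h]

lemma ofReal_monoInd (e : Finset V) (x : V → C) : ((monoInd ℝ e x : ℝ) : ℂ) = monoInd ℂ e x := by
  unfold monoInd
  split_ifs <;> simp

lemma norm_one_add_mul_monoInd_le {z : ℂ} (hz : ‖1 + z‖ ≤ 1) (e : Finset V) (x : V → C) :
    ‖1 + z * monoInd ℂ e x‖ ≤ 1 := by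
  rcases monoInd_eq_zero_or_one ℂ e x with h | h <;> simp [h, hz]

lemma edgeProb_nonneg (q : ℕ) (e : Finset V) : 0 ≤ edgeProb q e := by
  unfold edgeProb; positivity

variable [DecidableEq V]

lemma pairProb_nonneg (q : ℕ) (e f : Finset V) : 0 ≤ pairProb q e f := by
  unfold pairProb edgeProb; positivity

lemma edgeProb_mul_edgeProb_le_pairProb {q : ℕ} (hq : 1 ≤ q) (e f : Finset V) :
    edgeProb q e * edgeProb q f ≤ pairProb q e f :=
  le_mul_of_one_le_right (mul_nonneg (edgeProb_nonneg _ _) (edgeProb_nonneg _ _))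
    (one_le_pow₀ (by exact_mod_cast hq))

/-- The sum of the pair probabilities over the hyperedges of `E` which meet `e` outside `u`. -/
noncomputable def neighborSum (q : ℕ) (E : Finset (Finset V)) (e : Finset V) (u : V) : ℝ :=
  ∑ f ∈ E.erase e with ¬ e ∩ f ⊆ {u}, pairProb q e f

variable [Fintype V] [Fintype C] [Nonempty C]

/-- By size bias, the first average is p_e times that of the recolored product. All factors have
norm at most 1, so replacing them one at a time costs only the dropped factor at e and those f that
recoloring can affect. -/
lemma norm_expect_monoInd_mul_prod_sub_le {E : Finset (Finset V)} (hE : ∀ e ∈ E, e.Nonempty)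
    {z : Finset V → ℂ} (hz : ∀ e ∈ E, ‖1 + z e‖ ≤ 1) {e : Finset V} (he : e ∈ E) {u : V}
    (hu : u ∈ e) :
    ‖𝔼 x : V → C, monoInd ℂ e x * ∏ f ∈ E.erase e, (1 + z f * monoInd ℂ f x) -
      edgeProb (Fintype.card C) e * 𝔼 x : V → C, ∏ f ∈ E, (1 + z f * monoInd ℂ f x)‖ ≤
    2 * edgeProb (Fintype.card C) e ^ 2 + 4 * neighborSum (Fintype.card C) E e u := by
  set q := Fintype.card C with hq
  have hq1 : 1 ≤ q := Fintype.card_pos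
  have hz2 : ∀ f ∈ E, ‖z f‖ ≤ 2 := by
    intro f hf
    have h := norm_sub_le (1 + z f) 1
    rw [add_sub_cancel_left, norm_one] at h
    linarith [hz f hf]
  have hcast : ((q : ℂ)⁻¹) ^ (e.card - 1) = (edgeProb q e : ℂ) := by
    simp [edgeProb]
  rw [expect_monoInd_mul hu, ← hq, hcast, ← mul_sub, ← Finset.expect_sub_distrib, norm_mul,
    Complex.norm_real, Real.norm_of_nonneg (edgeProb_nonneg _ _)]
  have hpt : ∀ x : V → C,
      ‖∏ f ∈ E.erase e, (1 + z f * monoInd ℂ f (recolor (e.erase u) u x)) -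
        ∏ f ∈ E, (1 + z f * monoInd ℂ f x)‖ ≤
      2 * monoInd ℝ e x + ∑ f ∈ E.erase e with ¬ e ∩ f ⊆ {u},
        2 * (monoInd ℝ f (recolor (e.erase u) u x) + monoInd ℝ f x) := by
    intro x
    -- A factor 1 in place of the missing e lets both products range over E.
    have h1 : ∏ f ∈ E.erase e, (1 + z f * monoInd ℂ f (recolor (e.erase u) u x)) =
        ∏ f ∈ E, (if f = e then 1 else (1 + z f * monoInd ℂ f (recolor (e.erase u) u x))) := by
      rw [← Finset.mul_prod_erase E _ he, if_pos rfl, one_mul]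
      exact Finset.prod_congr rfl fun f hf => by rw [if_neg (Finset.ne_of_mem_erase hf)]
    rw [h1]
    refine (norm_prod_sub_prod_le _ _ _ ?_ ?_).trans ?_
    · intro f hf
      split_ifs
      · simp
      · exact norm_one_add_mul_monoInd_le (hz f hf) _ _
    · exact fun f hf => norm_one_add_mul_monoInd_le (hz f hf) _ _
    · rw [← Finset.add_sum_erase E _ he, if_pos rfl, Finset.sum_filter]
      have hnorm : ∀ (f : Finset V) (y : V → C), ‖monoInd ℂ f y‖ = monoInd ℝ f y := by
        intro f y
        rw [← ofReal_monoInd, Complex.norm_real, Real.norm_of_nonneg (monoInd_nonneg _ _)]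
      refine add_le_add ?_ (Finset.sum_le_sum fun f hf => ?_)
      · rw [sub_add_cancel_left, norm_neg, norm_mul, hnorm]
        exact mul_le_mul_of_nonneg_right (hz2 e he) (monoInd_nonneg _ _)
      · rw [if_neg (Finset.ne_of_mem_erase hf), add_sub_add_left_eq_sub, ← mul_sub, norm_mul]
        split_ifs with hsub
        · rw [monoInd_recolor_of_inter_subset hsub]
          simp
        · refine mul_le_mul (hz2 f (Finset.mem_of_mem_erase hf)) ?_ (norm_nonneg _) zero_le_two
          refine (norm_sub_le _ _).trans ?_
          rw [hnorm, hnorm]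
  -- The size-bias identity read backwards turns the recolored indicator into a pair probability.
  have hsb : ∀ f : Finset V, edgeProb q e * 𝔼 x : V → C, monoInd ℝ f (recolor (e.erase u) u x) =
      𝔼 x : V → C, monoInd ℝ e x * monoInd ℝ f x := by
    intro f
    rw [expect_monoInd_mul hu]
    rfl
  calc _ ≤ edgeProb q e * 𝔼 x : V → C, (2 * monoInd ℝ e x + ∑ f ∈ E.erase e with ¬ e ∩ f ⊆ {u},
        2 * (monoInd ℝ f (recolor (e.erase u) u x) + monoInd ℝ f x)) := by
        refine mul_le_mul_of_nonneg_left ((norm_expect_le _).trans ?_) (edgeProb_nonneg _ _)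
        exact Finset.expect_le_expect fun x _ => hpt x
    _ = 2 * edgeProb q e ^ 2 + ∑ f ∈ E.erase e with ¬ e ∩ f ⊆ {u},
        2 * (pairProb q e f + edgeProb q e * edgeProb q f) := by
        rw [Finset.expect_add_distrib, Finset.expect_sum_comm, ← Finset.mul_expect,
          expect_monoInd ⟨u, hu⟩, mul_add, Finset.mul_sum]
        congr 1
        · rw [← hq]; ring
        · refine Finset.sum_congr rfl fun f hf => ?_
          have hfne := hE f (Finset.mem_of_mem_erase (Finset.mem_filter.1 hf).1)
          rw [← Finset.mul_expect, Finset.expect_add_distrib, mul_left_comm, mul_add, hsb,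
            expect_monoInd_mul_monoInd ⟨u, hu⟩ hfne, expect_monoInd hfne]
    _ ≤ _ := by
        rw [neighborSum, Finset.mul_sum]
        refine add_le_add le_rfl (Finset.sum_le_sum fun f _ => ?_)
        linarith [edgeProb_mul_edgeProb_le_pairProb hq1 e f]

/-- Poisson approximation of the generating function of the number of monochromatic hyperedges. -/
lemma norm_expect_prod_sub_exp_le {E : Finset (Finset V)} (hE : ∀ e ∈ E, e.Nonempty)
    {y : Finset V → ℂ} (hy : ∀ e ∈ E, ‖1 + y e‖ ≤ 1) {u : Finset V → V}
    (hu : ∀ e ∈ E, u e ∈ e) :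
    ‖𝔼 x : V → C, ∏ e ∈ E, (1 + y e * monoInd ℂ e x) -
      Complex.exp (∑ e ∈ E, edgeProb (Fintype.card C) e * y e)‖ ≤
    Real.exp (4 * ∑ e ∈ E, edgeProb (Fintype.card C) e) *
      (4 * ∑ e ∈ E, edgeProb (Fintype.card C) e ^ 2 +
        8 * ∑ e ∈ E, neighborSum (Fintype.card C) E e (u e)) := by
  set q := Fintype.card C with hq
  set L : ℂ := ∑ e ∈ E, edgeProb q e * y e with hL
  set Λ : ℝ := ∑ e ∈ E, edgeProb q e with hΛ
  set δ : ℝ := 4 * ∑ e ∈ E, edgeProb q e ^ 2 + 8 * ∑ e ∈ E, neighborSum q E e (u e) with hδ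
  have hy2 : ∀ f ∈ E, ‖y f‖ ≤ 2 := by
    intro f hf
    have h := norm_sub_le (1 + y f) 1
    rw [add_sub_cancel_left, norm_one] at h
    linarith [hy f hf]
  have hLn : ‖L‖ ≤ 2 * Λ := by
    rw [hL, hΛ, Finset.mul_sum]
    refine (norm_sum_le _ _).trans (Finset.sum_le_sum fun e he => ?_)
    rw [norm_mul, Complex.norm_real, Real.norm_of_nonneg (edgeProb_nonneg _ _), mul_comm]
    exact mul_le_mul_of_nonneg_right (hy2 e he) (edgeProb_nonneg _ _)
  set h : ℝ → ℂ := fun t => 𝔼 x : V → C, ∏ e ∈ E, (1 + (t : ℂ) * y e * monoInd ℂ e x) with hh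
  set h' : ℝ → ℂ := fun t => ∑ e ∈ E, y e *
    𝔼 x : V → C, monoInd ℂ e x * ∏ f ∈ E.erase e, (1 + (t : ℂ) * y f * monoInd ℂ f x) with hh'
  have hder : ∀ t : ℝ, HasDerivAt h (h' t) t := by
    intro t
    have h1 : ∀ (x : V → C), ∀ e ∈ E, HasDerivAt
        (fun t : ℝ => 1 + (t : ℂ) * y e * monoInd ℂ e x) (y e * monoInd ℂ e x) t := by
      intro x e _
      have h0 : HasDerivAt (fun t : ℝ => (t : ℂ)) 1 t := Complex.ofRealCLM.hasDerivAt
      simpa using ((h0.mul_const (y e)).mul_const (monoInd ℂ e x)).const_add 1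
    have h2 := HasDerivAt.fun_sum (u := Finset.univ)
      (fun (x : V → C) _ => HasDerivAt.fun_finsetProd (h1 x))
    have h3 := h2.div_const (Fintype.card (V → C) : ℂ)
    have e1 : h = fun t : ℝ => (∑ x : V → C, ∏ e ∈ E, (1 + (t : ℂ) * y e * monoInd ℂ e x)) /
        (Fintype.card (V → C) : ℂ) := by
      funext t
      exact Fintype.expect_eq_sum_div_card _
    rw [e1]
    refine h3.congr_deriv ?_
    rw [hh', ← Fintype.expect_eq_sum_div_card, Finset.expect_sum_comm]
    refine Finset.sum_congr rfl fun e _ => ?_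
    rw [Finset.mul_expect]
    refine Finset.expect_congr rfl fun x _ => ?_
    rw [smul_eq_mul]
    ring
  have hbound : ∀ t ∈ Set.Icc (0 : ℝ) 1, ‖h' t - L * h t‖ ≤ δ := by
    intro t ht
    -- 1 + t y_e is a convex combination of 1 and 1 + y_e, so the unit-disk condition holds along
    -- the whole path.
    have hz : ∀ e ∈ E, ‖1 + (t : ℂ) * y e‖ ≤ 1 := by
      intro e he
      have e1 : 1 + (t : ℂ) * y e = ((1 - t : ℝ) : ℂ) * 1 + (t : ℂ) * (1 + y e) := by
        push_cast; ring
      rw [e1]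
      refine (norm_add_le _ _).trans ?_
      rw [norm_mul, norm_mul, Complex.norm_real, Complex.norm_real, norm_one,
        Real.norm_of_nonneg ht.1, Real.norm_of_nonneg (sub_nonneg.2 ht.2)]
      nlinarith [hy e he, ht.1]
    have e2 : h' t - L * h t = ∑ e ∈ E, y e *
        (𝔼 x : V → C, monoInd ℂ e x * ∏ f ∈ E.erase e, (1 + (t : ℂ) * y f * monoInd ℂ f x) -
        edgeProb q e * 𝔼 x : V → C, ∏ f ∈ E, (1 + (t : ℂ) * y f * monoInd ℂ f x)) := by
      rw [hh', hL, Finset.sum_mul, ← Finset.sum_sub_distrib]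
      refine Finset.sum_congr rfl fun e _ => ?_
      rw [hh]
      ring
    rw [e2, hδ]
    refine (norm_sum_le _ _).trans ?_
    rw [Finset.mul_sum, Finset.mul_sum, ← Finset.sum_add_distrib]
    refine Finset.sum_le_sum fun e he => ?_
    rw [norm_mul]
    refine (mul_le_mul (hy2 e he) (norm_expect_monoInd_mul_prod_sub_le hE (z := fun f => t * y f)
      hz he (hu e he)) (norm_nonneg _) zero_le_two).trans (le_of_eq ?_)
    ring
  have hΛ0 : 0 ≤ Λ := Finset.sum_nonneg fun e _ => edgeProb_nonneg _ _
  have hexp : ∀ t ∈ Set.Icc (0 : ℝ) 1, ‖Complex.exp (-(t : ℂ) * L)‖ ≤ Real.exp (2 * Λ) := by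
    intro t ht
    rw [Complex.norm_exp]
    refine Real.exp_le_exp.2 ((Complex.re_le_norm _).trans ?_)
    rw [norm_mul, norm_neg, Complex.norm_real, Real.norm_of_nonneg ht.1]
    nlinarith [ht.2, norm_nonneg L, ht.1]
  have hδ0 : 0 ≤ δ := (norm_nonneg _).trans (hbound 0 (by simp))
  -- The integrating factor exp(-tL) removes L h, leaving a derivative of norm at most δ exp(2Λ).
  have hG : ∀ t : ℝ, HasDerivAt (fun t : ℝ => h t * Complex.exp (-(t : ℂ) * L))
      ((h' t - L * h t) * Complex.exp (-(t : ℂ) * L)) t := by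
    intro t
    have h0 : HasDerivAt (fun t : ℝ => (t : ℂ)) 1 t := Complex.ofRealCLM.hasDerivAt
    have h1 : HasDerivAt (fun t : ℝ => Complex.exp (-(t : ℂ) * L))
      (Complex.exp (-(t : ℂ) * L) * (-1 * L)) t := (h0.neg.mul_const L).cexp
    exact ((hder t).mul h1).congr_deriv (by ring)
  have hmv := norm_image_sub_le_of_norm_deriv_le_segment_01' (C := δ * Real.exp (2 * Λ))
    (fun t _ => (hG t).hasDerivWithinAt) (fun t ht => by
      have ht' : t ∈ Set.Icc (0 : ℝ) 1 := ⟨ht.1, ht.2.le⟩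
      rw [norm_mul]
      exact mul_le_mul (hbound t ht') (hexp t ht') (norm_nonneg _) hδ0)
  have hh1 : h 1 = 𝔼 x : V → C, ∏ e ∈ E, (1 + y e * monoInd ℂ e x) := by simp [hh]
  have hh0 : h 0 = 1 := by simp [hh]
  rw [← hh1]
  have e3 : h 1 - Complex.exp L = Complex.exp L *
      (h 1 * Complex.exp (-((1 : ℝ) : ℂ) * L) - h 0 * Complex.exp (-((0 : ℝ) : ℂ) * L)) := by
    have : Complex.exp L * Complex.exp (-L) = 1 := by rw [← Complex.exp_add]; simp
    rw [hh0]
    simp only [Complex.ofReal_one, Complex.ofReal_zero, neg_zero, zero_mul, Complex.exp_zero,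
      neg_one_mul]
    linear_combination (-h 1) * this
  have hL2 : ‖Complex.exp L‖ ≤ Real.exp (2 * Λ) := by
    rw [Complex.norm_exp]
    exact Real.exp_le_exp.2 ((Complex.re_le_norm _).trans hLn)
  rw [e3, norm_mul]
  refine (mul_le_mul hL2 hmv (norm_nonneg _) (Real.exp_nonneg _)).trans (le_of_eq ?_)
  -- One exp(2Λ) bounds exp L, the other bounds the integrating factor.
  rw [show 4 * Λ = 2 * Λ + 2 * Λ by ring, Real.exp_add]
  ring

end GeneratingFunction

/-! ### Bounds on overlapping pairs and the choice of roots. -/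

section Overlap

variable {V : Type*}

lemma edgeProb_mul_pow {q : ℕ} (hq : 1 ≤ q) {e : Finset V} {k : ℕ} (hk : k ≤ e.card - 1) :
    edgeProb q e * (q : ℝ) ^ k = ((q : ℝ)⁻¹) ^ (e.card - 1 - k) := by
  have hq0 : (q : ℝ) ≠ 0 := by positivity
  rw [edgeProb]
  nth_rewrite 1 [← Nat.sub_add_cancel hk]
  rw [pow_add, mul_assoc, ← mul_pow, inv_mul_cancel₀ hq0, one_pow, mul_one]

lemma edgeProb_le_inv {q : ℕ} (hq : 1 ≤ q) {e : Finset V} (he : 2 ≤ e.card) :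
    edgeProb q e ≤ (q : ℝ)⁻¹ := by
  rw [edgeProb]
  have : (q : ℝ)⁻¹ ≤ 1 := inv_le_one_of_one_le₀ (by exact_mod_cast hq)
  exact pow_le_of_le_one (by positivity) this (by omega)

lemma sum_edgeProb_sq_le {q : ℕ} (hq : 1 ≤ q) {E : Finset (Finset V)}
    (hE : ∀ e ∈ E, 2 ≤ e.card) :
    ∑ e ∈ E, edgeProb q e ^ 2 ≤ (q : ℝ)⁻¹ * ∑ e ∈ E, edgeProb q e := by
  rw [Finset.mul_sum]
  refine Finset.sum_le_sum fun e he => ?_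
  rw [sq]
  exact mul_le_mul_of_nonneg_right (edgeProb_le_inv hq (hE e he)) (edgeProb_nonneg _ _)

variable [DecidableEq V]

/-- The sum of the pair probabilities over the pairs of distinct hyperedges sharing at least two
vertices. -/
noncomputable def overlapSum (q : ℕ) (E F : Finset (Finset V)) : ℝ :=
  ∑ e ∈ E, ∑ f ∈ F, if f ≠ e ∧ 2 ≤ (e ∩ f).card then pairProb q e f else 0

lemma overlapSum_nonneg (q : ℕ) (E F : Finset (Finset V)) : 0 ≤ overlapSum q E F := by
  refine Finset.sum_nonneg fun e _ => Finset.sum_nonneg fun f _ => ?_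
  split_ifs
  exacts [pairProb_nonneg _ _ _, le_rfl]

lemma pairProb_comm (q : ℕ) (e f : Finset V) : pairProb q e f = pairProb q f e := by
  rw [pairProb, pairProb, Finset.inter_comm, mul_comm (edgeProb q e)]

lemma overlapSum_comm (q : ℕ) (E F : Finset (Finset V)) : overlapSum q E F = overlapSum q F E := by
  rw [overlapSum, Finset.sum_comm]
  refine Finset.sum_congr rfl fun f _ => Finset.sum_congr rfl fun e _ => ?_
  simp only [pairProb_comm q e f, Finset.inter_comm e f, ne_comm]

lemma overlapSum_biUnion {ι : Type*} [Fintype ι] (q : ℕ) (E : ι → Finset (Finset V))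
    (hE : Pairwise (Function.onFun Disjoint E)) :
    overlapSum q (Finset.univ.biUnion E) (Finset.univ.biUnion E) =
      ∑ i, ∑ j, overlapSum q (E i) (E j) := by
  have hE' : (↑(Finset.univ : Finset ι) : Set ι).PairwiseDisjoint E := fun i _ j _ h => hE h
  unfold overlapSum
  rw [Finset.sum_biUnion hE']
  refine Finset.sum_congr rfl fun i _ => ?_
  rw [Finset.sum_comm]
  rw [Finset.sum_biUnion hE']
  exact Finset.sum_congr rfl fun j _ => Finset.sum_comm

lemma pairProb_self {q : ℕ} (hq : 1 ≤ q) (e : Finset V) : pairProb q e e = edgeProb q e := by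
  rw [pairProb, Finset.inter_self, mul_assoc, edgeProb_mul_pow hq le_rfl]
  simp

/-- The overlap sum of a hypergraph is controlled by the difference between the variance and the
mean of the number of monochromatic hyperedges. -/
lemma overlapSum_self_le {q : ℕ} (hq : 2 ≤ q) (E : Finset (Finset V)) :
    overlapSum q E E ≤ 2 * (∑ e ∈ E, ∑ f ∈ E, (pairProb q e f - edgeProb q e * edgeProb q f) -
      ∑ e ∈ E, edgeProb q e + ∑ e ∈ E, edgeProb q e ^ 2) := by
  have hq1 : 1 ≤ q := by omega
  rw [← Finset.sum_sub_distrib, ← Finset.sum_add_distrib, Finset.mul_sum]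
  refine Finset.sum_le_sum fun e he => ?_
  rw [← Finset.add_sum_erase E _ he, ← Finset.add_sum_erase E _ he, pairProb_self hq1,
    if_neg (by simp)]
  have : ∑ f ∈ E.erase e, (if f ≠ e ∧ 2 ≤ (e ∩ f).card then pairProb q e f else 0) ≤
      ∑ f ∈ E.erase e, 2 * (pairProb q e f - edgeProb q e * edgeProb q f) := by
    refine Finset.sum_le_sum fun f _ => ?_
    split_ifs with h
    · have hpp := mul_nonneg (edgeProb_nonneg q e) (edgeProb_nonneg q f)
      -- Two common vertices and q ≥ 2 make the pair probability at least 2 p_e p_f, hence at most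
      -- twice the covariance.
      have h2 : (2 : ℝ) ≤ (q : ℝ) ^ ((e ∩ f).card - 1) :=
        (show (2 : ℝ) ≤ q by exact_mod_cast hq).trans
          (le_self_pow₀ (by exact_mod_cast hq1) (by omega))
      have h3 := mul_le_mul_of_nonneg_left h2 hpp
      rw [pairProb]
      linarith
    · have := edgeProb_mul_edgeProb_le_pairProb hq1 e f
      linarith
  rw [← Finset.mul_sum] at this
  linarith

/-- Expanding the square gives pairs (e, f), each counted for at most 2 ^ r sets S ⊆ e ∩ f. Off the
diagonal the weight is at most the pair probability. On it, κ bounds p_e q^(|S|-1), the conditional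
probability that e is monochromatic given that S is. -/
lemma sum_pow_mul_sum_sq_le {q : ℕ} (hq : 1 ≤ q) {E : Finset (Finset V)} {r : ℕ}
    (hE : ∀ e ∈ E, e.card ≤ r) {𝓢 : Finset (Finset V)} (h𝓢 : ∀ S ∈ 𝓢, 2 ≤ S.card) {κ : ℝ}
    (hκ0 : 0 ≤ κ)
    (hκ : ∀ e ∈ E, ∀ S ∈ 𝓢, S ⊆ e → edgeProb q e * (q : ℝ) ^ (S.card - 1) ≤ κ) :
    ∑ S ∈ 𝓢, (q : ℝ) ^ (S.card - 1) * (∑ e ∈ E with S ⊆ e, edgeProb q e) ^ 2 ≤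
      2 ^ r * (overlapSum q E E + κ * ∑ e ∈ E, edgeProb q e) := by
  have hcount : ∀ e ∈ E, ∀ f : Finset V, ((𝓢.filter (fun S => S ⊆ e ∧ S ⊆ f)).card : ℝ) ≤
      2 ^ r := by
    intro e he f
    have h1 : (𝓢.filter (fun S => S ⊆ e ∧ S ⊆ f)) ⊆ e.powerset := by
      intro S hS
      exact Finset.mem_powerset.2 (Finset.mem_filter.1 hS).2.1
    have h2 := (Finset.card_le_card h1).trans (Finset.card_powerset e).le
    have h3 := h2.trans (Nat.pow_le_pow_right two_pos (hE e he))
    exact_mod_cast h3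
  have hexpand : ∑ S ∈ 𝓢, (q : ℝ) ^ (S.card - 1) * (∑ e ∈ E with S ⊆ e, edgeProb q e) ^ 2 =
      ∑ e ∈ E, ∑ f ∈ E, ∑ S ∈ 𝓢 with S ⊆ e ∧ S ⊆ f,
        edgeProb q e * edgeProb q f * (q : ℝ) ^ (S.card - 1) := by
    simp_rw [sq, Finset.sum_filter, Finset.sum_mul_sum, Finset.mul_sum]
    rw [Finset.sum_comm]
    refine Finset.sum_congr rfl fun e _ => ?_
    rw [Finset.sum_comm]
    refine Finset.sum_congr rfl fun f _ => Finset.sum_congr rfl fun S _ => ?_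
    by_cases h1 : S ⊆ e <;> by_cases h2 : S ⊆ f <;> simp [h1, h2]
    ring
  rw [hexpand, mul_add, overlapSum, Finset.mul_sum, Finset.mul_sum, Finset.mul_sum,
    ← Finset.sum_add_distrib]
  refine Finset.sum_le_sum fun e he => ?_
  rw [← Finset.add_sum_erase E _ he, add_comm, Finset.mul_sum]
  refine add_le_add ?_ ?_
  · refine (Finset.sum_le_sum fun f hf => ?_).trans
      (Finset.sum_le_sum_of_subset_of_nonneg (Finset.erase_subset e E) fun f _ _ => ?_)
    · split_ifs with h
      · have h1 : ∀ S ∈ 𝓢.filter (fun S => S ⊆ e ∧ S ⊆ f),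
            edgeProb q e * edgeProb q f * (q : ℝ) ^ (S.card - 1) ≤ pairProb q e f := by
          intro S hS
          have hS' := (Finset.mem_filter.1 hS).2
          have := Finset.card_le_card (Finset.subset_inter hS'.1 hS'.2)
          refine mul_le_mul_of_nonneg_left ?_ (mul_nonneg (edgeProb_nonneg _ _)
            (edgeProb_nonneg _ _))
          exact pow_le_pow_right₀ (by exact_mod_cast hq) (by omega)
        refine (Finset.sum_le_card_nsmul _ _ _ h1).trans ?_
        rw [nsmul_eq_mul]
        exact mul_le_mul_of_nonneg_right (hcount e he f) (pairProb_nonneg _ _ _)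
      · rw [Finset.filter_eq_empty_iff.2]
        · simp
        · rintro S hS ⟨h1, h2⟩
          exact h ⟨Finset.ne_of_mem_erase hf,
            (h𝓢 S hS).trans (Finset.card_le_card (Finset.subset_inter h1 h2))⟩
    · split_ifs
      · exact mul_nonneg (by positivity) (pairProb_nonneg _ _ _)
      · simp
  · have h1 : ∀ S ∈ 𝓢.filter (fun S => S ⊆ e ∧ S ⊆ e),
        edgeProb q e * edgeProb q e * (q : ℝ) ^ (S.card - 1) ≤ κ * edgeProb q e := by
      intro S hS
      have hS' := Finset.mem_filter.1 hS
      rw [mul_assoc, mul_comm]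
      exact mul_le_mul_of_nonneg_right (hκ e he S hS'.1 hS'.2.1) (edgeProb_nonneg _ _)
    refine (Finset.sum_le_card_nsmul _ _ _ h1).trans ?_
    rw [nsmul_eq_mul]
    exact mul_le_mul_of_nonneg_right (hcount e he e) (mul_nonneg hκ0 (edgeProb_nonneg _ _))

/-- Overlaps between two uniform hypergraphs are controlled by the overlaps inside each of them. -/
lemma overlapSum_sq_le [Fintype V] {q : ℕ} (hq : 1 ≤ q) {E F : Finset (Finset V)} {r s : ℕ}
    (hrs : r ≤ s) (hE : ∀ e ∈ E, e.card = r) (hF : ∀ f ∈ F, f.card = s) :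
    overlapSum q E F ^ 2 ≤ (2 ^ r * (overlapSum q E E + 1 * ∑ e ∈ E, edgeProb q e)) *
      (2 ^ s * (overlapSum q F F + (q : ℝ)⁻¹ * ∑ f ∈ F, edgeProb q f)) := by
  -- Only S smaller than the edges of F are used, so on the diagonal of F one may take κ = 1/q; S
  -- may fill an edge of E, where κ = 1 suffices.
  set 𝓢 : Finset (Finset V) := Finset.univ.filter (fun S => 2 ≤ S.card ∧ S.card < s) with h𝓢
  have hmem : ∀ S, S ∈ 𝓢 ↔ 2 ≤ S.card ∧ S.card < s := by simp [h𝓢]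
  have hq0 : (0 : ℝ) ≤ (q : ℝ)⁻¹ := by positivity
  have hq1 : (q : ℝ)⁻¹ ≤ 1 := inv_le_one_of_one_le₀ (by exact_mod_cast hq)
  have h1 := sum_pow_mul_sum_sq_le hq (fun e he => (hE e he).le) (𝓢 := 𝓢)
    (fun S hS => ((hmem S).1 hS).1) zero_le_one (fun e he S hS hSe => by
      have := Finset.card_le_card hSe
      rw [edgeProb_mul_pow hq (by omega)]
      exact pow_le_one₀ hq0 hq1)
  have h2 := sum_pow_mul_sum_sq_le hq (fun e he => (hF e he).le) (𝓢 := 𝓢)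
    (fun S hS => ((hmem S).1 hS).1) hq0 (fun e he S hS hSe => by
      have h3 := (hmem S).1 hS
      have h4 := hF e he
      rw [edgeProb_mul_pow hq (by omega)]
      exact pow_le_of_le_one hq0 hq1 (by omega))
  have h3 : overlapSum q E F ≤ ∑ S ∈ 𝓢, (q : ℝ) ^ (S.card - 1) *
      ((∑ e ∈ E with S ⊆ e, edgeProb q e) * (∑ f ∈ F with S ⊆ f, edgeProb q f)) := by
    have hexpand : ∑ S ∈ 𝓢, (q : ℝ) ^ (S.card - 1) *
        ((∑ e ∈ E with S ⊆ e, edgeProb q e) * (∑ f ∈ F with S ⊆ f, edgeProb q f)) =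
        ∑ e ∈ E, ∑ f ∈ F, ∑ S ∈ 𝓢 with S ⊆ e ∧ S ⊆ f,
          edgeProb q e * edgeProb q f * (q : ℝ) ^ (S.card - 1) := by
      simp_rw [Finset.sum_filter, Finset.sum_mul_sum, Finset.mul_sum]
      rw [Finset.sum_comm]
      refine Finset.sum_congr rfl fun e _ => ?_
      rw [Finset.sum_comm]
      refine Finset.sum_congr rfl fun f _ => Finset.sum_congr rfl fun S _ => ?_
      by_cases h1 : S ⊆ e <;> by_cases h2 : S ⊆ f <;> simp [h1, h2]
      ring
    rw [hexpand]
    refine Finset.sum_le_sum fun e he => Finset.sum_le_sum fun f hf => ?_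
    have hnn : ∀ S ∈ 𝓢.filter (fun S => S ⊆ e ∧ S ⊆ f),
        0 ≤ edgeProb q e * edgeProb q f * (q : ℝ) ^ (S.card - 1) := fun S _ =>
      mul_nonneg (mul_nonneg (edgeProb_nonneg _ _) (edgeProb_nonneg _ _)) (by positivity)
    split_ifs with h
    · refine Finset.single_le_sum hnn (Finset.mem_filter.2
        ⟨(hmem (e ∩ f)).2 ⟨h.2, ?_⟩, Finset.inter_subset_left, Finset.inter_subset_right⟩)
      rw [← hF f hf]
      -- If e ∩ f were all of f, then f ⊆ e and r ≤ s would force f = e, which the overlap sum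
      -- excludes.
      refine Finset.card_lt_card (Finset.inter_subset_right.ssubset_of_ne fun h4 => ?_)
      have h5 : f ⊆ e := Finset.inter_eq_right.1 h4
      refine h.1 (Finset.eq_of_subset_of_card_le h5 ?_)
      rw [hE e he, hF f hf]
      exact hrs
    · exact Finset.sum_nonneg hnn
  refine (pow_le_pow_left₀ (overlapSum_nonneg _ _ _) h3 2).trans ?_
  refine (Finset.sum_sq_le_sum_mul_sum_of_sq_le_mul 𝓢
    (f := fun S => (q : ℝ) ^ (S.card - 1) * (∑ e ∈ E with S ⊆ e, edgeProb q e) ^ 2)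
    (g := fun S => (q : ℝ) ^ (S.card - 1) * (∑ f ∈ F with S ⊆ f, edgeProb q f) ^ 2)
    (fun S _ => by positivity) (fun S _ => by positivity) (fun S _ => le_of_eq (by ring))).trans ?_
  exact mul_le_mul h1 h2 (Finset.sum_nonneg fun S _ => by positivity)
    ((Finset.sum_nonneg fun S _ => by positivity).trans h1)

/-- The expected number of monochromatic hyperedges of `E` containing the vertex `v`. -/
noncomputable def weightedDegree (q : ℕ) (E : Finset (Finset V)) (v : V) : ℝ :=
  ∑ f ∈ E with v ∈ f, edgeProb q f

lemma weightedDegree_nonneg (q : ℕ) (E : Finset (Finset V)) (v : V) :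
    0 ≤ weightedDegree q E v :=
  Finset.sum_nonneg fun _ _ => edgeProb_nonneg _ _

/-- An f meeting e outside u either shares two vertices with e or meets it in a single v ≠ u; in the
latter case the pair probability is just p_e p_f, which is charged to v. -/
lemma neighborSum_le (q : ℕ) (E : Finset (Finset V)) (e : Finset V) (u : V) :
    neighborSum q E e u ≤
      (∑ f ∈ E, if f ≠ e ∧ 2 ≤ (e ∩ f).card then pairProb q e f else 0) +
      ∑ v ∈ e.erase u, edgeProb q e * weightedDegree q E v := by
  have h1 : ∑ v ∈ e.erase u, edgeProb q e * weightedDegree q E v =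
      ∑ f ∈ E, ∑ v ∈ e.erase u, if v ∈ f then edgeProb q e * edgeProb q f else 0 := by
    rw [Finset.sum_comm]
    refine Finset.sum_congr rfl fun v _ => ?_
    rw [weightedDegree, Finset.mul_sum, Finset.sum_filter]
  have hpp : ∀ f : Finset V, 0 ≤ edgeProb q e * edgeProb q f := fun f =>
    mul_nonneg (edgeProb_nonneg _ _) (edgeProb_nonneg _ _)
  have hnn : ∀ f : Finset V, ∀ v ∈ e.erase u,
      0 ≤ if v ∈ f then edgeProb q e * edgeProb q f else 0 := by
    intro f v _
    split_ifs
    exacts [hpp f, le_rfl]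
  have hA : ∀ f : Finset V, 0 ≤ if f ≠ e ∧ 2 ≤ (e ∩ f).card then pairProb q e f else 0 := by
    intro f
    split_ifs
    exacts [pairProb_nonneg _ _ _, le_rfl]
  rw [h1, ← Finset.sum_add_distrib, neighborSum]
  refine (Finset.sum_le_sum fun f hf => ?_).trans (Finset.sum_le_sum_of_subset_of_nonneg
    ((Finset.filter_subset _ _).trans (Finset.erase_subset e E)) fun f _ _ =>
      add_nonneg (hA f) (Finset.sum_nonneg (hnn f)))
  obtain ⟨hf1, hf2⟩ := Finset.mem_filter.1 hf
  obtain ⟨v, hv, hvu⟩ := Finset.not_subset.1 hf2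
  rw [Finset.mem_singleton] at hvu
  rw [Finset.mem_inter] at hv
  by_cases h : 2 ≤ (e ∩ f).card
  · rw [if_pos ⟨Finset.ne_of_mem_erase hf1, h⟩]
    exact le_add_of_nonneg_right (Finset.sum_nonneg (hnn f))
  · have h2 := Finset.single_le_sum (hnn f) (Finset.mem_erase.2 ⟨hvu, hv.1⟩)
    rw [if_pos hv.2] at h2
    have h3 : (e ∩ f).card - 1 = 0 := by omega
    have h4 : pairProb q e f = edgeProb q e * edgeProb q f := by
      rw [pairProb, h3, pow_zero, mul_one]
    refine h4.le.trans ?_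
    exact h2.trans (le_add_of_nonneg_left (hA f))

lemma sum_weightedDegree_le [Fintype V] (q : ℕ) {E : Finset (Finset V)} {R : ℕ}
    (hR : ∀ e ∈ E, e.card ≤ R) :
    ∑ v, weightedDegree q E v ≤ R * ∑ e ∈ E, edgeProb q e := by
  simp_rw [weightedDegree, Finset.sum_filter]
  rw [Finset.sum_comm, Finset.mul_sum]
  refine Finset.sum_le_sum fun e he => ?_
  rw [← Finset.sum_filter, Finset.sum_const, nsmul_eq_mul, Finset.filter_univ_mem]
  exact mul_le_mul_of_nonneg_right (by exact_mod_cast hR e he) (edgeProb_nonneg _ _)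

/-- Expanding the square counts pairs (e, f) with at most R² ordered pairs of distinct common
vertices each. There are none unless e and f share two vertices, so only overlaps and the diagonal
remain. -/
lemma sum_codegree_sq_le [Fintype V] {q : ℕ} (hq : 1 ≤ q) {E : Finset (Finset V)} {R : ℕ}
    (hR : ∀ e ∈ E, e.card ≤ R) :
    ∑ p ∈ (Finset.univ : Finset V).offDiag,
      (∑ e ∈ E with p.1 ∈ e ∧ p.2 ∈ e, edgeProb q e) ^ 2 ≤
    (R : ℝ) ^ 2 * (overlapSum q E E + ∑ e ∈ E, edgeProb q e ^ 2) := by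
  have hexpand : ∑ p ∈ (Finset.univ : Finset V).offDiag,
      (∑ e ∈ E with p.1 ∈ e ∧ p.2 ∈ e, edgeProb q e) ^ 2 =
      ∑ e ∈ E, ∑ f ∈ E, ∑ p ∈ (e ∩ f).offDiag, edgeProb q e * edgeProb q f := by
    have h1 : ∀ e f : Finset V, ∑ p ∈ (e ∩ f).offDiag, edgeProb q e * edgeProb q f =
        ∑ p ∈ (Finset.univ : Finset V).offDiag,
          if (p.1 ∈ e ∧ p.2 ∈ e) ∧ (p.1 ∈ f ∧ p.2 ∈ f) then edgeProb q e * edgeProb q f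
          else 0 := by
      intro e f
      rw [← Finset.sum_filter]
      refine Finset.sum_congr ?_ fun _ _ => rfl
      ext p
      simp only [Finset.mem_offDiag, Finset.mem_filter, Finset.mem_inter, Finset.mem_univ]
      tauto
    simp_rw [h1, sq, Finset.sum_filter, Finset.sum_mul_sum]
    rw [Finset.sum_comm]
    refine Finset.sum_congr rfl fun e _ => ?_
    rw [Finset.sum_comm]
    refine Finset.sum_congr rfl fun f _ => Finset.sum_congr rfl fun p _ => ?_
    by_cases h1 : p.1 ∈ e ∧ p.2 ∈ e <;> by_cases h2 : p.1 ∈ f ∧ p.2 ∈ f <;> simp [h1, h2]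
  have hcard : ∀ e ∈ E, ∀ f : Finset V, ((e ∩ f).offDiag.card : ℝ) ≤ (R : ℝ) ^ 2 := by
    intro e he f
    have h1 : (e ∩ f).card ≤ R := (Finset.card_le_card Finset.inter_subset_left).trans (hR e he)
    rw [Finset.offDiag_card]
    have h2 : (e ∩ f).card * (e ∩ f).card - (e ∩ f).card ≤ R ^ 2 :=
      (Nat.sub_le _ _).trans ((Nat.mul_le_mul h1 h1).trans_eq (sq R).symm)
    exact_mod_cast h2
  rw [hexpand, overlapSum, ← Finset.sum_add_distrib, Finset.mul_sum]
  refine Finset.sum_le_sum fun e he => ?_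
  rw [← Finset.add_sum_erase E _ he, add_comm, mul_add, Finset.mul_sum]
  refine add_le_add ?_ ?_
  · refine (Finset.sum_le_sum fun f hf => ?_).trans
      (Finset.sum_le_sum_of_subset_of_nonneg (Finset.erase_subset e E) fun f _ _ => ?_)
    · rw [Finset.sum_const, nsmul_eq_mul]
      split_ifs with h
      · exact mul_le_mul (hcard e he f) (edgeProb_mul_edgeProb_le_pairProb hq e f)
          (mul_nonneg (edgeProb_nonneg _ _) (edgeProb_nonneg _ _)) (by positivity)
      · have h2 : (e ∩ f).card ≤ 1 := by
          by_contra h3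
          exact h ⟨Finset.ne_of_mem_erase hf, by omega⟩
        have h4 : (e ∩ f).offDiag.card = 0 := by
          rw [Finset.offDiag_card]
          interval_cases (e ∩ f).card <;> rfl
        simp [h4]
    · split_ifs
      · exact mul_nonneg (by positivity) (pairProb_nonneg _ _ _)
      · simp
  · rw [Finset.sum_const, nsmul_eq_mul, ← sq]
    exact mul_le_mul_of_nonneg_right (hcard e he e) (sq_nonneg _)

/-- Rooting each hyperedge at a vertex of maximal weighted degree makes the neighbor sums small. -/
lemma exists_root_sum_neighborSum_le [Fintype V] {q : ℕ} (hq : 1 ≤ q) {E : Finset (Finset V)}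
    (hne : E.Nonempty) (hE : ∀ e ∈ E, e.Nonempty) {R : ℕ} (hR : ∀ e ∈ E, e.card ≤ R) :
    ∃ u : Finset V → V, (∀ e ∈ E, u e ∈ e) ∧ ∑ e ∈ E, neighborSum q E e (u e) ≤
      overlapSum q E E + √((R : ℝ) ^ 2 * (overlapSum q E E + ∑ e ∈ E, edgeProb q e ^ 2) *
        (R * ∑ e ∈ E, edgeProb q e) ^ 2) := by
  have hmax : ∀ e ∈ E, ∃ u ∈ e, ∀ v ∈ e, weightedDegree q E v ≤ weightedDegree q E u :=
    fun e he => Finset.exists_max_image e _ (hE e he)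
  have : Nonempty V := ⟨(hE _ hne.choose_spec).choose⟩
  choose! u hu hmaxu using hmax
  refine ⟨u, hu, ?_⟩
  set D := weightedDegree q E with hD
  have hD0 : ∀ v, 0 ≤ D v := weightedDegree_nonneg q E
  -- Maximality of D at the root gives D(v) ≤ √(D(u) D(v)). This form is symmetric in the vertex
  -- pair and ready for Cauchy–Schwarz.
  have h1 : ∑ e ∈ E, ∑ v ∈ e.erase (u e), edgeProb q e * D v ≤
      ∑ p ∈ (Finset.univ : Finset V).offDiag,
        (∑ e ∈ E with p.1 ∈ e ∧ p.2 ∈ e, edgeProb q e) * √(D p.1 * D p.2) := by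
    have hexpand : ∑ p ∈ (Finset.univ : Finset V).offDiag,
        (∑ e ∈ E with p.1 ∈ e ∧ p.2 ∈ e, edgeProb q e) * √(D p.1 * D p.2) =
        ∑ e ∈ E, ∑ p ∈ e.offDiag, edgeProb q e * √(D p.1 * D p.2) := by
      have h2 : ∀ e : Finset V, ∑ p ∈ e.offDiag, edgeProb q e * √(D p.1 * D p.2) =
          ∑ p ∈ (Finset.univ : Finset V).offDiag,
            if p.1 ∈ e ∧ p.2 ∈ e then edgeProb q e * √(D p.1 * D p.2) else 0 := by
        intro e
        rw [← Finset.sum_filter]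
        refine Finset.sum_congr ?_ fun _ _ => rfl
        ext p
        simp only [Finset.mem_offDiag, Finset.mem_filter, Finset.mem_univ]
        tauto
      simp_rw [h2, Finset.sum_mul, Finset.sum_filter]
      exact Finset.sum_comm
    rw [hexpand]
    refine Finset.sum_le_sum fun e he => ?_
    have h3 : ∑ v ∈ e.erase (u e), edgeProb q e * D v ≤
        ∑ p ∈ (e.erase (u e)).image (fun v => (u e, v)), edgeProb q e * √(D p.1 * D p.2) := by
      rw [Finset.sum_image (fun a _ b _ hab => (Prod.ext_iff.1 hab).2)]
      refine Finset.sum_le_sum fun v hv => ?_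
      refine mul_le_mul_of_nonneg_left (Real.le_sqrt_of_sq_le ?_) (edgeProb_nonneg _ _)
      rw [sq]
      exact mul_le_mul_of_nonneg_right (hmaxu e he v (Finset.mem_of_mem_erase hv)) (hD0 v)
    refine h3.trans (Finset.sum_le_sum_of_subset_of_nonneg ?_ fun p _ _ =>
      mul_nonneg (edgeProb_nonneg _ _) (Real.sqrt_nonneg _))
    intro p hp
    obtain ⟨v, hv, rfl⟩ := Finset.mem_image.1 hp
    rw [Finset.mem_erase] at hv
    exact Finset.mem_offDiag.2 ⟨hu e he, hv.2, hv.1.symm⟩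
  have h2 : ∑ p ∈ (Finset.univ : Finset V).offDiag, √(D p.1 * D p.2) ^ 2 ≤
      (R * ∑ e ∈ E, edgeProb q e) ^ 2 := by
    calc _ = ∑ p ∈ (Finset.univ : Finset V).offDiag, D p.1 * D p.2 :=
          Finset.sum_congr rfl fun p _ => Real.sq_sqrt (mul_nonneg (hD0 _) (hD0 _))
      _ ≤ ∑ p ∈ Finset.univ ×ˢ Finset.univ, D p.1 * D p.2 :=
          Finset.sum_le_sum_of_subset_of_nonneg (by simp) fun p _ _ => mul_nonneg (hD0 _) (hD0 _)
      _ = (∑ v, D v) ^ 2 := by rw [sq, Finset.sum_mul_sum, Finset.sum_product]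
      _ ≤ _ := pow_le_pow_left₀ (Finset.sum_nonneg fun v _ => hD0 v)
          (sum_weightedDegree_le q hR) 2
  have h3 := Finset.sum_mul_sq_le_sq_mul_sq (Finset.univ : Finset V).offDiag
    (fun p => ∑ e ∈ E with p.1 ∈ e ∧ p.2 ∈ e, edgeProb q e) (fun p => √(D p.1 * D p.2))
  have h4 := h3.trans (mul_le_mul (sum_codegree_sq_le hq hR) h2
    (Finset.sum_nonneg fun p _ => sq_nonneg _) (mul_nonneg (sq_nonneg _)
      (add_nonneg (overlapSum_nonneg _ _ _) (Finset.sum_nonneg fun e _ => sq_nonneg _))))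
  calc _ ≤ ∑ e ∈ E, ((∑ f ∈ E, if f ≠ e ∧ 2 ≤ (e ∩ f).card then pairProb q e f else 0) +
        ∑ v ∈ e.erase (u e), edgeProb q e * D v) :=
        Finset.sum_le_sum fun e _ => neighborSum_le q E e (u e)
    _ = overlapSum q E E + ∑ e ∈ E, ∑ v ∈ e.erase (u e), edgeProb q e * D v := by
        rw [Finset.sum_add_distrib, overlapSum]
    _ ≤ _ := add_le_add le_rfl (h1.trans (Real.le_sqrt_of_sq_le h4))

end Overlap

/-! ### From edge indicators to the joint counts of the layers. -/

section Multiplex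

variable {V C : Type*}

/-- The number of monochromatic hyperedges of `E` is a sum of indicators. -/
noncomputable def monoSum (E : Finset (Finset V)) (x : V → C) : ℕ := ∑ e ∈ E, monoInd ℕ e x

lemma cast_monoInd (K : Type*) [Semiring K] (e : Finset V) (x : V → C) :
    ((monoInd ℕ e x : ℕ) : K) = monoInd K e x := by
  unfold monoInd
  split_ifs <;> simp

/-- The hyperedges of a hypergraph on a finite vertex set, as a `Finset`. -/
noncomputable def edgeFinset [Fintype V] (H : Hypergraph V) : Finset (Finset V) := by
  classical exact Finset.univ.filter fun e => (e : Set V) ∈ H.edgeSet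

lemma mem_edgeFinset [Fintype V] {H : Hypergraph V} {e : Finset V} :
    e ∈ edgeFinset H ↔ (e : Set V) ∈ H.edgeSet := by
  simp [edgeFinset]

lemma monoCount_eq_monoSum [Fintype V] (H : Hypergraph V) (x : V → C) :
    monoCount H x = monoSum (edgeFinset H) x := by
  classical
  have h : {e | e ∈ H.edgeSet ∧ IsMonochromatic x e} =
      (fun e : Finset V => (e : Set V)) ''
        (((edgeFinset H).filter fun e => IsMonochromatic x (e : Set V) : Finset (Finset V)) :
          Set (Finset V)) := by
    ext e
    simp only [Set.mem_ofPred_eq, Set.mem_image, Finset.coe_filter, mem_edgeFinset]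
    constructor
    · intro he
      exact ⟨e.toFinite.toFinset, by simpa using he, by simp⟩
    · rintro ⟨f, hf, rfl⟩
      exact hf
  rw [monoCount, h, Set.ncard_image_of_injective _ Finset.coe_injective, Set.ncard_coe_finset,
    monoSum, Finset.card_filter]
  rfl

variable [DecidableEq V] [Fintype V] [Fintype C] [Nonempty C]

lemma expect_monoSum {E : Finset (Finset V)} (hE : ∀ e ∈ E, e.Nonempty) :
    𝔼 x : V → C, (monoSum E x : ℝ) = ∑ e ∈ E, edgeProb (Fintype.card C) e := by
  simp only [monoSum, Nat.cast_sum, cast_monoInd]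
  rw [Finset.expect_sum_comm]
  exact Finset.sum_congr rfl fun e he => expect_monoInd (hE e he)

lemma expect_monoSum_sq {E : Finset (Finset V)} (hE : ∀ e ∈ E, e.Nonempty) :
    𝔼 x : V → C, (monoSum E x : ℝ) ^ 2 = ∑ e ∈ E, ∑ f ∈ E, pairProb (Fintype.card C) e f := by
  simp only [monoSum, Nat.cast_sum, cast_monoInd, sq, Finset.sum_mul_sum]
  rw [Finset.expect_sum_comm]
  refine Finset.sum_congr rfl fun e he => ?_
  rw [Finset.expect_sum_comm]
  exact Finset.sum_congr rfl fun f hf => expect_monoInd_mul_monoInd (hE e he) (hE f hf)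

/-- The error in the Poisson approximation of the number of monochromatic hyperedges of a
hypergraph with mean `Λ`, sum of squared probabilities `s`, overlap sum `A`, and hyperedges of size
at most `R`. -/
noncomputable def poissonError (R : ℕ) (Λ s A : ℝ) : ℝ :=
  Real.exp (4 * Λ) * (4 * s + 8 * (A + √((R : ℝ) ^ 2 * (A + s) * (R * Λ) ^ 2)))

lemma norm_expect_prod_sub_exp_le_poissonError {E : Finset (Finset V)}
    (hE : ∀ e ∈ E, e.Nonempty) {R : ℕ} (hR : ∀ e ∈ E, e.card ≤ R)
    {y : Finset V → ℂ} (hy : ∀ e ∈ E, ‖1 + y e‖ ≤ 1) :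
    ‖𝔼 x : V → C, ∏ e ∈ E, (1 + y e * monoInd ℂ e x) -
      Complex.exp (∑ e ∈ E, edgeProb (Fintype.card C) e * y e)‖ ≤
    poissonError R (∑ e ∈ E, edgeProb (Fintype.card C) e)
      (∑ e ∈ E, edgeProb (Fintype.card C) e ^ 2) (overlapSum (Fintype.card C) E E) := by
  rcases E.eq_empty_or_nonempty with rfl | hne
  · simp [poissonError, overlapSum]
  · obtain ⟨u, hu, hsum⟩ := exists_root_sum_neighborSum_le (q := Fintype.card C)
      Fintype.card_pos hne hE hR
    refine (norm_expect_prod_sub_exp_le hE hy hu).trans ?_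
    refine mul_le_mul_of_nonneg_left ?_ (Real.exp_nonneg _)
    linarith

/-- Poisson approximation of the joint generating function of the numbers of monochromatic
hyperedges of several disjoint hypergraphs. -/
lemma norm_expect_prod_pow_sub_exp_le {ι : Type*} [Fintype ι] {E : ι → Finset (Finset V)}
    (hdisj : Pairwise (Function.onFun Disjoint E)) (hE : ∀ i, ∀ e ∈ E i, e.Nonempty) {R : ℕ}
    (hR : ∀ i, ∀ e ∈ E i, e.card ≤ R) {z : ι → ℂ} (hz : ∀ i, ‖z i‖ ≤ 1) :
    ‖𝔼 x : V → C, ∏ i, z i ^ monoSum (E i) x -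
      Complex.exp (∑ i, (∑ e ∈ E i, edgeProb (Fintype.card C) e : ℝ) * (z i - 1))‖ ≤
    poissonError R (∑ i, ∑ e ∈ E i, edgeProb (Fintype.card C) e)
      (∑ i, ∑ e ∈ E i, edgeProb (Fintype.card C) e ^ 2)
      (∑ i, ∑ j, overlapSum (Fintype.card C) (E i) (E j)) := by
  classical
  have hdisj' : (↑(Finset.univ : Finset ι) : Set ι).PairwiseDisjoint E :=
    fun i _ j _ h => hdisj h
  -- Disjointness of the layers leaves at most one nonzero summand, so y_e is z_i - 1 for the layer
  -- i containing e.
  set y : Finset V → ℂ := fun e => ∑ i, if e ∈ E i then z i - 1 else 0 with hy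
  have hyi : ∀ i, ∀ e ∈ E i, y e = z i - 1 := by
    intro i e he
    rw [hy]
    simp only
    rw [Finset.sum_eq_single i, if_pos he]
    · intro j _ hji
      exact if_neg fun hj => Finset.disjoint_left.1 (hdisj hji) hj he
    · simp
  have hpow : ∀ x : V → C, ∏ i, z i ^ monoSum (E i) x =
      ∏ e ∈ Finset.univ.biUnion E, (1 + y e * monoInd ℂ e x) := by
    intro x
    rw [Finset.prod_biUnion hdisj']
    refine Finset.prod_congr rfl fun i _ => ?_
    rw [monoSum, ← Finset.prod_pow_eq_pow_sum]
    refine Finset.prod_congr rfl fun e he => ?_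
    rw [hyi i e he]
    unfold monoInd
    split_ifs <;> simp
  have hexp : ∑ i, ((∑ e ∈ E i, edgeProb (Fintype.card C) e : ℝ) : ℂ) * (z i - 1) =
      ∑ e ∈ Finset.univ.biUnion E, edgeProb (Fintype.card C) e * y e := by
    rw [Finset.sum_biUnion hdisj']
    refine Finset.sum_congr rfl fun i _ => ?_
    rw [Complex.ofReal_sum, Finset.sum_mul]
    exact Finset.sum_congr rfl fun e he => by rw [hyi i e he]
  simp only [hpow]
  rw [hexp, ← Finset.sum_biUnion hdisj', ← Finset.sum_biUnion hdisj',
    ← overlapSum_biUnion _ E hdisj]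
  refine norm_expect_prod_sub_exp_le_poissonError ?_ ?_ ?_
  · intro e he
    obtain ⟨i, -, hi⟩ := Finset.mem_biUnion.1 he
    exact hE i e hi
  · intro e he
    obtain ⟨i, -, hi⟩ := Finset.mem_biUnion.1 he
    exact hR i e hi
  · intro e he
    obtain ⟨i, -, hi⟩ := Finset.mem_biUnion.1 he
    rw [hyi i e hi, add_sub_cancel]
    exact hz i

end Multiplex

/-! ### The law of a random coloring. -/

section Law

variable {V Ω : Type*} [Fintype V] [DecidableEq V] [MeasurableSpace Ω] {P : Measure Ω} {c : ℕ}
  {X : V → Ω → Fin c}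

/-- The expectation of a function of a uniformly random coloring is its average over all
colorings. -/
lemma IsUniformColoring.integral_eq_expect {K : Type*} [RCLike K] [IsProbabilityMeasure P]
    (hX : IsUniformColoring P X) (g : (V → Fin c) → K) :
    ∫ ω, g (fun v => X v ω) ∂P = 𝔼 x : V → Fin c, g x := by
  have hmeas : Measurable (fun ω v => X v ω) := measurable_pi_lambda _ hX.measurable
  have : IsProbabilityMeasure (P.map (fun ω v => X v ω)) :=
    Measure.isProbabilityMeasure_map hmeas.aemeasurable
  have hpt : ∀ x : V → Fin c, (P.map (fun ω v => X v ω)).real {x} =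
      ((c : ℝ) ^ Fintype.card V)⁻¹ := by
    intro x
    rw [measureReal_def, Measure.map_apply hmeas (measurableSet_singleton x)]
    have h1 : (fun ω v => X v ω) ⁻¹' {x} = ⋂ v ∈ (Finset.univ : Finset V), X v ⁻¹' {x v} := by
      ext ω
      simp [funext_iff]
    rw [h1, hX.indep.measure_inter_preimage_eq_mul Finset.univ
      (fun v _ => measurableSet_singleton (x v))]
    have h2 : ∀ v, P (X v ⁻¹' {x v}) = (c : ℝ≥0∞)⁻¹ := fun v => hX.prob_eq v (x v)
    simp [h2]
  rw [← integral_map (f := g) hmeas.aemeasurable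
    (Measurable.of_discrete (f := g)).aestronglyMeasurable,
    integral_fintype (Integrable.of_finite), Fintype.expect_eq_sum_div_card]
  simp only [hpt, Fintype.card_fun, Fintype.card_fin]
  rw [← Finset.smul_sum, RCLike.real_smul_eq_coe_mul, div_eq_inv_mul]
  simp

end Law

/-! ### Vanishing of the error terms. -/

section Limit

lemma tendsto_poissonError {R : ℕ} {Λ s A : ℕ → ℝ} {l : ℝ} (hΛ : Tendsto Λ atTop (𝓝 l))
    (hs : Tendsto s atTop (𝓝 0)) (hA : Tendsto A atTop (𝓝 0)) :
    Tendsto (fun n => poissonError R (Λ n) (s n) (A n)) atTop (𝓝 0) := by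
  have h1 : Tendsto (fun n => √((R : ℝ) ^ 2 * (A n + s n) * (R * Λ n) ^ 2)) atTop
      (𝓝 √((R : ℝ) ^ 2 * (0 + 0) * (R * l) ^ 2)) :=
    ((tendsto_const_nhds.mul (hA.add hs)).mul ((tendsto_const_nhds.mul hΛ).pow 2)).sqrt
  have h2 := ((hΛ.const_mul 4).rexp).mul ((hs.const_mul 4).add ((hA.add h1).const_mul 8))
  simpa [poissonError] using h2

variable {ι : Type*} {V : ℕ → Type*} {E : ∀ n, ι → Finset (Finset (V n))}
  {r : ι → ℕ} {c : ℕ → ℕ} {lam : ι → ℝ}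

lemma tendsto_natCast_inv (hc : Tendsto c atTop atTop) :
    Tendsto (fun n => (c n : ℝ)⁻¹) atTop (𝓝 0) :=
  tendsto_inv_atTop_zero.comp (tendsto_natCast_atTop_atTop.comp hc)

/-- Edges have at least two vertices, so p_e ≤ 1/c and the sum is at most mean/c. -/
lemma tendsto_sum_edgeProb_sq (hr : ∀ i, 2 ≤ r i) (hE : ∀ n i, ∀ e ∈ E n i, e.card = r i)
    (hc : Tendsto c atTop atTop)
    (hmean : ∀ i, Tendsto (fun n => ∑ e ∈ E n i, edgeProb (c n) e) atTop (𝓝 (lam i))) (i : ι) :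
    Tendsto (fun n => ∑ e ∈ E n i, edgeProb (c n) e ^ 2) atTop (𝓝 0) := by
  have h := (tendsto_natCast_inv hc).mul (hmean i)
  rw [zero_mul] at h
  refine tendsto_of_tendsto_of_tendsto_of_le_of_le' tendsto_const_nhds h
    (Eventually.of_forall fun n => Finset.sum_nonneg fun e _ => sq_nonneg _) ?_
  filter_upwards [hc.eventually_ge_atTop 1] with n hn
  exact sum_edgeProb_sq_le hn fun e he => (hr i).trans_eq (hE n i e he).symm

variable [∀ n, DecidableEq (V n)]

lemma tendsto_overlapSum_self (hr : ∀ i, 2 ≤ r i) (hE : ∀ n i, ∀ e ∈ E n i, e.card = r i)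
    (hc : Tendsto c atTop atTop)
    (hmean : ∀ i, Tendsto (fun n => ∑ e ∈ E n i, edgeProb (c n) e) atTop (𝓝 (lam i)))
    (hvar : ∀ i, Tendsto (fun n => ∑ e ∈ E n i, ∑ f ∈ E n i,
      (pairProb (c n) e f - edgeProb (c n) e * edgeProb (c n) f)) atTop (𝓝 (lam i))) (i : ι) :
    Tendsto (fun n => overlapSum (c n) (E n i) (E n i)) atTop (𝓝 0) := by
  have h := (((hvar i).sub (hmean i)).add (tendsto_sum_edgeProb_sq hr hE hc hmean i)).const_mul 2
  rw [sub_self, add_zero, mul_zero] at h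
  refine tendsto_of_tendsto_of_tendsto_of_le_of_le' tendsto_const_nhds h
    (Eventually.of_forall fun n => overlapSum_nonneg _ _ _) ?_
  filter_upwards [hc.eventually_ge_atTop 2] with n hn
  exact overlapSum_self_le hn _

variable [∀ n, Fintype (V n)]

lemma tendsto_overlapSum (hr : ∀ i, 2 ≤ r i) (hE : ∀ n i, ∀ e ∈ E n i, e.card = r i)
    (hc : Tendsto c atTop atTop)
    (hmean : ∀ i, Tendsto (fun n => ∑ e ∈ E n i, edgeProb (c n) e) atTop (𝓝 (lam i)))
    (hvar : ∀ i, Tendsto (fun n => ∑ e ∈ E n i, ∑ f ∈ E n i,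
      (pairProb (c n) e f - edgeProb (c n) e * edgeProb (c n) f)) atTop (𝓝 (lam i))) (i j : ι) :
    Tendsto (fun n => overlapSum (c n) (E n i) (E n j)) atTop (𝓝 0) := by
  wlog hij : r i ≤ r j generalizing i j
  · simp only [fun n => overlapSum_comm (c n) (E n i) (E n j)]
    exact this j i (le_of_not_ge hij)
  have hself := tendsto_overlapSum_self hr hE hc hmean hvar
  -- The first Cauchy–Schwarz factor only stays bounded; the second tends to 0 thanks to κ = 1/c.
  have h := ((((hself i).add ((hmean i).const_mul 1)).const_mul (2 ^ r i)).mul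
    (((hself j).add ((tendsto_natCast_inv hc).mul (hmean j))).const_mul (2 ^ r j)))
  simp only [zero_mul, add_zero, mul_zero] at h
  have hsq : Tendsto (fun n => overlapSum (c n) (E n i) (E n j) ^ 2) atTop (𝓝 0) := by
    refine tendsto_of_tendsto_of_tendsto_of_le_of_le' tendsto_const_nhds h
      (Eventually.of_forall fun n => sq_nonneg _) ?_
    filter_upwards [hc.eventually_ge_atTop 1] with n hn
    exact overlapSum_sq_le hn hij (hE n i) (hE n j)
  have hsqrt := hsq.sqrt
  simpa only [Real.sqrt_zero, Real.sqrt_sq (overlapSum_nonneg _ _ _)] using hsqrt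

variable [Fintype ι]

/-- Convergence of the joint generating functions of the numbers of monochromatic hyperedges. -/
lemma tendsto_expect_prod_pow (hr : ∀ i, 2 ≤ r i) (hE : ∀ n i, ∀ e ∈ E n i, e.card = r i)
    (hdisj : ∀ n, Pairwise (Function.onFun Disjoint (E n))) (hc : Tendsto c atTop atTop)
    (hmean : ∀ i, Tendsto (fun n => ∑ e ∈ E n i, edgeProb (c n) e) atTop (𝓝 (lam i)))
    (hvar : ∀ i, Tendsto (fun n => ∑ e ∈ E n i, ∑ f ∈ E n i,
      (pairProb (c n) e f - edgeProb (c n) e * edgeProb (c n) f)) atTop (𝓝 (lam i)))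
    {z : ι → ℂ} (hz : ∀ i, ‖z i‖ ≤ 1) :
    Tendsto (fun n => 𝔼 x : V n → Fin (c n), ∏ i, z i ^ monoSum (E n i) x) atTop
      (𝓝 (Complex.exp (∑ i, (lam i : ℂ) * (z i - 1)))) := by
  have hexp : Tendsto (fun n => Complex.exp (∑ i,
      ((∑ e ∈ E n i, edgeProb (c n) e : ℝ) : ℂ) * (z i - 1))) atTop
      (𝓝 (Complex.exp (∑ i, (lam i : ℂ) * (z i - 1)))) :=
    (tendsto_finsetSum _ fun i _ =>
      ((Complex.continuous_ofReal.tendsto _).comp (hmean i)).mul_const _).cexp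
  have hA : Tendsto (fun n => ∑ i, ∑ j, overlapSum (c n) (E n i) (E n j)) atTop (𝓝 0) := by
    simpa using tendsto_finsetSum Finset.univ fun i _ => tendsto_finsetSum Finset.univ fun j _ =>
      tendsto_overlapSum hr hE hc hmean hvar i j
  have hs : Tendsto (fun n => ∑ i, ∑ e ∈ E n i, edgeProb (c n) e ^ 2) atTop (𝓝 0) := by
    simpa using tendsto_finsetSum Finset.univ fun i _ =>
      tendsto_sum_edgeProb_sq hr hE hc hmean i
  have herr := tendsto_poissonError (R := ∑ i, r i)
    (tendsto_finsetSum Finset.univ fun i _ => hmean i) hs hA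
  have hsub : Tendsto (fun n => 𝔼 x : V n → Fin (c n), ∏ i, z i ^ monoSum (E n i) x -
      Complex.exp (∑ i, ((∑ e ∈ E n i, edgeProb (c n) e : ℝ) : ℂ) * (z i - 1))) atTop (𝓝 0) := by
    refine squeeze_zero_norm' ?_ herr
    filter_upwards [hc.eventually_ge_atTop 1] with n hn
    have : Nonempty (Fin (c n)) := ⟨⟨0, hn⟩⟩
    have h := norm_expect_prod_pow_sub_exp_le (C := Fin (c n)) (hdisj n) (R := ∑ i, r i)
      (fun i e he => Finset.card_pos.1 (by have := hr i; have := hE n i e he; omega))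
      (fun i e he => (hE n i e he).le.trans
        (Finset.single_le_sum (fun _ _ => Nat.zero_le _) (Finset.mem_univ i))) hz
    simpa only [Fintype.card_fin] using h
  simpa using hsub.add hexp

end Limit

/-! ### Characteristic functions and the limit theorem. -/

/-- The joint characteristic function of integer-valued random variables is given by their joint
generating function. -/
lemma charFun_map_toLp_natCast {Ω ι : Type*} [Fintype ι] [MeasurableSpace Ω] {P : Measure Ω}
    {T : ι → Ω → ℕ} (hT : ∀ i, AEMeasurable (T i) P) (t : EuclideanSpace ℝ ι) :
    charFun (P.map (fun ω => WithLp.toLp 2 (fun i => (T i ω : ℝ)))) t =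
      ∫ ω, ∏ i, Complex.exp (t i * Complex.I) ^ T i ω ∂P := by
  have hT' : ∀ i, AEMeasurable (fun ω => (T i ω : ℝ)) P := fun i =>
    measurable_from_nat.comp_aemeasurable (hT i)
  have hmeas : AEMeasurable (fun ω => WithLp.toLp 2 (fun i => (T i ω : ℝ))) P :=
    (WithLp.measurable_toLp 2 _).comp_aemeasurable (aemeasurable_pi_lambda _ hT')
  rw [charFun_apply, integral_map hmeas (by fun_prop)]
  refine integral_congr_ae (Eventually.of_forall fun ω => ?_)
  simp only [PiLp.inner_apply, ← Complex.exp_nat_mul, ← Complex.exp_sum]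
  congr 1
  push_cast
  rw [Finset.sum_mul]
  refine Finset.sum_congr rfl fun i _ => ?_
  simp
  ring

lemma charFun_map_toLp_poisson {Ω ι : Type*} [Fintype ι] [MeasurableSpace Ω] {Q : Measure Ω}
    {Z : ι → Ω → ℕ} {lam : ι → ℝ≥0} [IsProbabilityMeasure Q]
    (hZ : ∀ i, HasLaw (Z i) (poissonMeasure (lam i)) Q) (hindep : iIndepFun Z Q)
    (t : EuclideanSpace ℝ ι) :
    charFun (Q.map (fun ω => WithLp.toLp 2 (fun i => (Z i ω : ℝ)))) t =
      Complex.exp (∑ i, ((lam i : ℝ) : ℂ) * (Complex.exp (t i * Complex.I) - 1)) := by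
  have hcast : Measurable (Nat.cast : ℕ → ℝ) := measurable_from_nat
  have hindep' : iIndepFun (fun i ω => (Z i ω : ℝ)) Q := hindep.comp (fun _ => Nat.cast)
    fun _ => hcast
  have hmeas : ∀ i, AEMeasurable (fun ω => (Z i ω : ℝ)) Q := fun i =>
    hcast.comp_aemeasurable (hZ i).aemeasurable
  rw [(iIndepFun_iff_charFun_pi hmeas).1 hindep' t, Complex.exp_sum]
  refine Finset.prod_congr rfl fun i _ => ?_
  rw [← charFun_map_cast_poissonMeasure, ← (hZ i).map_eq,
    AEMeasurable.map_map_of_aemeasurable hcast.aemeasurable (hZ i).aemeasurable]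
  rfl

theorem proposition1p4
    (d : ℕ) (hd : 1 ≤ d)
    -- the orders of uniformity and the limiting means of the layers
    (r : Fin d → ℕ) (hr : ∀ i, 2 ≤ r i) (lam : Fin d → ℝ≥0)
    -- the sequence of multiplexes, on finite vertex sets
    (V : ℕ → Type*) [∀ n, Finite (V n)]
    (H : ∀ n, Hypermultiplex (V n) d)
    (hunif : ∀ n i, ((H n).layer i).IsUniform (r i))
    -- the numbers of colors, and the uniformly random colorings of the vertices
    (c : ℕ → ℕ) (hc : Tendsto c atTop atTop)
    (Ω : ℕ → Type*) [∀ n, MeasurableSpace (Ω n)]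
    (P : ∀ n, Measure (Ω n)) [∀ n, IsProbabilityMeasure (P n)]
    (X : ∀ n, V n → Ω n → Fin (c n))
    (hX : ∀ n, IsUniformColoring (P n) (X n))
    -- convergence of the means and variances
    (hmean : ∀ i, Tendsto
      (fun n => ∫ ω, (monoCount ((H n).layer i) (fun v => X n v ω) : ℝ) ∂(P n))
      atTop (𝓝 (lam i : ℝ)))
    (hvar : ∀ i, Tendsto
      (fun n => variance (fun ω => (monoCount ((H n).layer i) (fun v => X n v ω) : ℝ)) (P n))
      atTop (𝓝 (lam i : ℝ)))
    -- the hyperedge sets of the layers are pairwise disjoint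
    (hdisj : ∀ n i j, i ≠ j →
      ((H n).layer i).edgeSet ∩ ((H n).layer j).edgeSet = ∅)
    -- independent Poisson random variables `Z 1, …, Z d` with means `lam 1, …, lam d`
    (Ω' : Type*) [MeasurableSpace Ω'] (Q : Measure Ω') [IsProbabilityMeasure Q]
    (Z : Fin d → Ω' → ℕ)
    (hZ : ∀ i, HasLaw (Z i) (poissonMeasure (lam i)) Q)
    (hZindep : iIndepFun Z Q) :
    TendstoInDistribution
      (fun n ω => (fun i => (monoCount ((H n).layer i) (fun v => X n v ω) : ℝ) : Fin d → ℝ))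
      atTop
      (fun ω' => (fun i => (Z i ω' : ℝ) : Fin d → ℝ))
      P Q := by
  classical
  have := fun n => Fintype.ofFinite (V n)
  set E : ∀ n, Fin d → Finset (Finset (V n)) := fun n i => edgeFinset ((H n).layer i) with hE_def
  set T : ∀ n, Fin d → Ω n → ℕ := fun n i ω => monoSum (E n i) (fun v => X n v ω) with hT_def
  have hT : ∀ n i ω, monoCount ((H n).layer i) (fun v => X n v ω) = T n i ω := fun n i ω =>
    monoCount_eq_monoSum _ _
  simp only [hT] at hmean hvar ⊢
  have hmeasX : ∀ n, Measurable (fun ω v => X n v ω) := fun n =>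
    measurable_pi_lambda _ (hX n).measurable
  have hmeas : ∀ n i, Measurable (T n i) := fun n i =>
    (Measurable.of_discrete (f := fun x : V n → Fin (c n) => monoSum (E n i) x)).comp (hmeasX n)
  have hEcard : ∀ n i, ∀ e ∈ E n i, e.card = r i := by
    intro n i e he
    rw [← hunif n i e (mem_edgeFinset.1 he), Set.ncard_coe_finset]
  have hEne : ∀ n i, ∀ e ∈ E n i, e.Nonempty := fun n i e he =>
    Finset.card_pos.1 (by have := hr i; have := hEcard n i e he; omega)
  have hEdisj : ∀ n, Pairwise (Function.onFun Disjoint (E n)) := by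
    intro n i j hij
    refine Finset.disjoint_left.2 fun e hei hej => ?_
    have h : (e : Set (V n)) ∈ ((H n).layer i).edgeSet ∩ ((H n).layer j).edgeSet :=
      ⟨mem_edgeFinset.1 hei, mem_edgeFinset.1 hej⟩
    rw [hdisj n i j hij] at h
    exact h
  -- The averaging identities need a nonempty color set, which is available eventually because c
  -- tends to infinity.
  have hmean_eq : ∀ n i, 1 ≤ c n →
      ∫ ω, (T n i ω : ℝ) ∂(P n) = ∑ e ∈ E n i, edgeProb (c n) e := by
    intro n i hn
    have : Nonempty (Fin (c n)) := ⟨⟨0, hn⟩⟩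
    have h := expect_monoSum (C := Fin (c n)) (hEne n i)
    rw [Fintype.card_fin] at h
    rw [← h]
    exact (hX n).integral_eq_expect (fun x => (monoSum (E n i) x : ℝ))
  have hvar_eq : ∀ n i, 1 ≤ c n → variance (fun ω => (T n i ω : ℝ)) (P n) =
      ∑ e ∈ E n i, ∑ f ∈ E n i,
        (pairProb (c n) e f - edgeProb (c n) e * edgeProb (c n) f) := by
    intro n i hn
    have : Nonempty (Fin (c n)) := ⟨⟨0, hn⟩⟩
    have hmem : MemLp (fun ω => (T n i ω : ℝ)) 2 (P n) := by
      obtain ⟨C, hC⟩ := (Set.finite_range fun x : V n → Fin (c n) =>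
        ‖(monoSum (E n i) x : ℝ)‖).bddAbove
      exact MemLp.of_bound (measurable_from_nat.comp (hmeas n i)).aestronglyMeasurable C
        (Eventually.of_forall fun ω => hC ⟨fun v => X n v ω, rfl⟩)
    have h := expect_monoSum_sq (C := Fin (c n)) (hEne n i)
    rw [Fintype.card_fin] at h
    rw [variance_eq_sub hmem, hmean_eq n i hn]
    simp_rw [Finset.sum_sub_distrib, ← Finset.sum_mul_sum]
    rw [← h, sq (∑ e ∈ E n i, edgeProb (c n) e)]
    congr 1
    exact (hX n).integral_eq_expect (fun x => (monoSum (E n i) x : ℝ) ^ 2)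
  have hmean' : ∀ i, Tendsto (fun n => ∑ e ∈ E n i, edgeProb (c n) e) atTop
      (𝓝 (lam i : ℝ)) := fun i => (hmean i).congr' (by
    filter_upwards [hc.eventually_ge_atTop 1] with n hn using hmean_eq n i hn)
  have hvar' : ∀ i, Tendsto (fun n => ∑ e ∈ E n i, ∑ f ∈ E n i,
      (pairProb (c n) e f - edgeProb (c n) e * edgeProb (c n) f)) atTop
      (𝓝 (lam i : ℝ)) := fun i => (hvar i).congr' (by
    filter_upwards [hc.eventually_ge_atTop 1] with n hn using hvar_eq n i hn)
  have hcast : Measurable (Nat.cast : ℕ → ℝ) := measurable_from_nat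
  -- Characteristic functions call for an inner product space; the limit is proved there and carried
  -- back along the continuous map `WithLp.ofLp`.
  have hmain : TendstoInDistribution
      (fun n ω => (WithLp.toLp 2 (fun i => (T n i ω : ℝ)) : EuclideanSpace ℝ (Fin d))) atTop
      (fun ω' => (WithLp.toLp 2 (fun i => (Z i ω' : ℝ)) : EuclideanSpace ℝ (Fin d))) P Q := by
    refine ⟨fun n => ?_, ?_, ?_⟩
    · exact ((WithLp.measurable_toLp 2 _).comp
        (measurable_pi_lambda _ fun i => hcast.comp (hmeas n i))).aemeasurable
    · exact (WithLp.measurable_toLp 2 _).comp_aemeasurable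
        (aemeasurable_pi_lambda _ fun i => hcast.comp_aemeasurable (hZ i).aemeasurable)
    · refine ProbabilityMeasure.tendsto_of_tendsto_charFun fun t => ?_
      simp only [ProbabilityMeasure.coe_mk]
      rw [charFun_map_toLp_poisson hZ hZindep]
      simp only [fun n => charFun_map_toLp_natCast (fun i => (hmeas n i).aemeasurable) t]
      refine (tendsto_expect_prod_pow (z := fun i => Complex.exp (t i * Complex.I)) hr hEcard
        hEdisj hc hmean' hvar' fun i => (Complex.norm_exp_ofReal_mul_I _).le).congr fun n => ?_
      exact ((hX n).integral_eq_expect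
        (fun x => ∏ i, Complex.exp (t i * Complex.I) ^ monoSum (E n i) x)).symm
  exact hmain.continuous_comp (g := WithLp.ofLp) (PiLp.continuous_ofLp 2 _)
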